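/- For integers $n\ge 4$ and $1\le k<n$, the Johnson graph $J(n,k)$ is paired 2-coverable. Here $J(n,k)$ is the graph whose vertices are the $k$-element subsets of $\{1,\dots,n\}$, two of them being adjacent if and only if they have exactly $k-1$ elements in common; and a graph is paired 2-coverable if for any four distinct vertices $u,v,x,y$ there are two vertex-disjoint paths, one joining $u$ to $v$ and one joining $x$ to $y$, that together contain every vertex of the graph. -/

import Mathlib

/-- The Johnson graph `J(n,k)`: the vertices are the `k`-element subsets of an `n`-element set, and
two of them are adjacent when they have exactly `k - 1` elements in common. (The condition is
written `#(s ∩ t) + 1 = k`, so that natural-number subtraction plays no role.) -/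
def johnsonGraph (n k : ℕ) : SimpleGraph {s : Finset (Fin n) // s.card = k} where
  Adj s t := (s.1 ∩ t.1).card + 1 = k
  symm := ⟨fun s t h => by rwa [Finset.inter_comm]⟩
  loopless := ⟨fun s h => by
    have hs := s.2
    rw [Finset.inter_self] at h
    omega⟩

/-- A graph is paired 2-coverable when for any four distinct vertices `u, v, x, y` there are two
vertex-disjoint paths, one joining `u` and `v` and one joining `x` and `y`, that together cover all
vertices. -/
def SimpleGraph.IsPairedTwoCoverable {V : Type*} (G : SimpleGraph V) : Prop :=
  ∀ u v x y : V, u ≠ v → u ≠ x → u ≠ y → v ≠ x → v ≠ y → x ≠ y →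
    ∃ (p : G.Walk u v) (q : G.Walk x y), p.IsPath ∧ q.IsPath ∧
      (∀ w, ¬ (w ∈ p.support ∧ w ∈ q.support)) ∧
      (∀ w, w ∈ p.support ∨ w ∈ q.support)

/-! Induction on the size of the ground set, inside `J(n,k)`: the `k`-sets between `C` and `D` span
a copy of `J(|D| - |C|, k - |C|)`. Choose `e` in `u` but not in `v`. The sets containing `e` and the
sets avoiding `e` form two smaller slices `A ∋ u` and `B ∋ v`, both paired 2-coverable by induction.
If `x` and `y` lie on different sides, two disjoint edges across, avoiding the terminals, link a
path pair of `A` to one of `B`. If they lie on the same side, a path pair there is extended by a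
Hamiltonian path of the other side (`HasPathPairOn.of_split`). The induction stops at complete
graphs and at the octahedron `J(4,2)`. -/

namespace SimpleGraph

variable {V : Type*} {G : SimpleGraph V}

/-! ### Paths and path pairs with prescribed vertex sets -/

/-- There is a path from `u` to `v` whose vertex set is exactly `S`. -/
def HasPathOn (G : SimpleGraph V) (S : Finset V) (u v : V) : Prop :=
  ∃ p : G.Walk u v, p.IsPath ∧ ∀ w, w ∈ p.support ↔ w ∈ S

/-- Any two distinct vertices of `S` are joined by a path with vertex set `S`. -/
def IsHamConnectedOn (G : SimpleGraph V) (S : Finset V) : Prop :=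
  ∀ u ∈ S, ∀ v ∈ S, u ≠ v → G.HasPathOn S u v

theorem HasPathOn.single (u : V) : G.HasPathOn {u} u u :=
  ⟨Walk.nil, by simp, by simp⟩

theorem HasPathOn.symm {S : Finset V} {u v : V} (h : G.HasPathOn S u v) : G.HasPathOn S v u := by
  obtain ⟨p, hp, hS⟩ := h
  exact ⟨p.reverse, hp.reverse, by simpa using hS⟩

/-- Two disjoint edges between `A` and `B` that avoid two given vertices on each side. -/
def HasTwoCrossingEdges (G : SimpleGraph V) (A B : Finset V) : Prop :=
  ∀ u x v y : V, ∃ a ∈ A, ∃ b ∈ A, ∃ a' ∈ B, ∃ b' ∈ B, G.Adj a a' ∧ G.Adj b b' ∧ a ≠ b ∧ a' ≠ b' ∧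
    a ≠ u ∧ a ≠ x ∧ b ≠ u ∧ b ≠ x ∧ a' ≠ v ∧ a' ≠ y ∧ b' ≠ v ∧ b' ≠ y

theorem HasTwoCrossingEdges.symm {A B : Finset V} (h : G.HasTwoCrossingEdges A B) :
    G.HasTwoCrossingEdges B A := by
  intro v y u x
  obtain ⟨a, ha, b, hb, a', ha', b', hb', h₁, h₂, h⟩ := h u x v y
  exact ⟨a', ha', b', hb', a, ha, b, hb, h₁.symm, h₂.symm, by tauto⟩

variable [DecidableEq V]

/-- `S` splits into the vertex sets of a path from `u` to `v` and of a path from `x` to `y`. -/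
def HasPathPairOn (G : SimpleGraph V) (S : Finset V) (u v x y : V) : Prop :=
  ∃ T R : Finset V, Disjoint T R ∧ T ∪ R = S ∧ G.HasPathOn T u v ∧ G.HasPathOn R x y

/-- Paired 2-coverability of the subgraph induced on `S`. -/
def IsPairedTwoCoverableOn (G : SimpleGraph V) (S : Finset V) : Prop :=
  ∀ u ∈ S, ∀ v ∈ S, ∀ x ∈ S, ∀ y ∈ S, u ≠ v → u ≠ x → u ≠ y → v ≠ x → v ≠ y → x ≠ y →
    G.HasPathPairOn S u v x y

theorem HasPathOn.append {S T : Finset V} {u a b v : V} (h₁ : G.HasPathOn S u a)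
    (h₂ : G.HasPathOn T b v) (hab : G.Adj a b) (hST : Disjoint S T) :
    G.HasPathOn (S ∪ T) u v := by
  obtain ⟨p, hp, hS⟩ := h₁
  obtain ⟨q, hq, hT⟩ := h₂
  have hsupp : (p.append (Walk.cons hab q)).support = p.support ++ q.support := by
    rw [Walk.support_append, Walk.support_cons, List.tail_cons]
  refine ⟨p.append (Walk.cons hab q), ?_, fun w => ?_⟩
  · rw [Walk.isPath_def, hsupp, List.nodup_append']
    refine ⟨hp.support_nodup, hq.support_nodup, fun w hw hw' => ?_⟩
    exact Finset.disjoint_left.1 hST ((hS w).1 hw) ((hT w).1 hw')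
  · rw [hsupp, List.mem_append, hS, hT, Finset.mem_union]

theorem HasPathOn.cons {T : Finset V} {u b v : V} (h : G.HasPathOn T b v) (hub : G.Adj u b)
    (hu : u ∉ T) : G.HasPathOn (insert u T) u v := by
  rw [Finset.insert_eq]
  exact (HasPathOn.single u).append h hub (Finset.disjoint_singleton_left.2 hu)

theorem HasPathOn.pair {u v : V} (h : G.Adj u v) : G.HasPathOn {u, v} u v :=
  (HasPathOn.single v).cons h (by simpa using h.ne)

theorem HasPathOn.triple {u w v : V} (h₁ : G.Adj u w) (h₂ : G.Adj w v) (huv : u ≠ v) :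
    G.HasPathOn {u, w, v} u v :=
  (HasPathOn.pair h₂).cons h₁ (by simp [h₁.ne, huv])

theorem HasPathPairOn.swap {S : Finset V} {u v x y : V} (h : G.HasPathPairOn S u v x y) :
    G.HasPathPairOn S x y u v := by
  obtain ⟨T, R, hd, rfl, h₁, h₂⟩ := h
  exact ⟨R, T, hd.symm, Finset.union_comm _ _, h₂, h₁⟩

theorem HasPathPairOn.symm_left {S : Finset V} {u v x y : V} (h : G.HasPathPairOn S u v x y) :
    G.HasPathPairOn S v u x y := by
  obtain ⟨T, R, hd, rfl, h₁, h₂⟩ := h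
  exact ⟨T, R, hd, rfl, h₁.symm, h₂⟩

theorem HasPathPairOn.symm_right {S : Finset V} {u v x y : V} (h : G.HasPathPairOn S u v x y) :
    G.HasPathPairOn S u v y x :=
  h.swap.symm_left.swap

theorem hasPathOn_of_clique {R : Finset V} : ∀ {u v : V}, u ∉ R → v ∈ R →
    (∀ s ∈ insert u R, ∀ t ∈ insert u R, s ≠ t → G.Adj s t) → G.HasPathOn (insert u R) u v := by
  induction R using Finset.strongInduction with
  | H R ih =>
    intro u v hu hv hR
    by_cases h : R = {v}
    · subst h
      exact HasPathOn.pair (hR _ (by simp) _ (by simp) (by simpa using hu))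
    · obtain ⟨w, hw, hwv⟩ : ∃ w ∈ R, w ≠ v := by
        by_contra! hcon
        exact h (Finset.eq_singleton_iff_unique_mem.2 ⟨hv, hcon⟩)
      have hins : insert w (R.erase w) = R := Finset.insert_erase hw
      have h₁ := ih (R.erase w) (Finset.erase_ssubset hw) (u := w) (v := v) (by simp)
        (by simp [hwv.symm, hv]) (by
          rw [hins]
          exact fun s hs t ht => hR s (Finset.mem_insert_of_mem hs) t (Finset.mem_insert_of_mem ht))
      rw [hins] at h₁
      refine h₁.cons (hR _ (by simp) _ (Finset.mem_insert_of_mem hw) ?_) hu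
      rintro rfl
      exact hu hw

theorem isPairedTwoCoverableOn_of_clique {S : Finset V}
    (hS : ∀ s ∈ S, ∀ t ∈ S, s ≠ t → G.Adj s t) : G.IsPairedTwoCoverableOn S := by
  intro u hu v hv x hx y hy huv hux huy hvx hvy hxy
  -- The edge `xy` is one path; the other runs through all remaining vertices.
  have hins : insert u (((S.erase x).erase y).erase u) = (S.erase x).erase y :=
    Finset.insert_erase (by simp [hu, hux, huy])
  have h := hasPathOn_of_clique (G := G) (R := ((S.erase x).erase y).erase u) (u := u) (v := v)
    (by simp) (by simp [hv, huv.symm, hvx, hvy]) (by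
      rw [hins]
      exact fun s hs t ht => hS s (by simp at hs; tauto) t (by simp at ht; tauto))
  rw [hins] at h
  refine ⟨_, {x, y}, ?_, ?_, h, HasPathOn.pair (hS x hx y hy hxy)⟩
  · rw [Finset.disjoint_left]
    simp
    tauto
  · ext w
    by_cases h₁ : w = x <;> by_cases h₂ : w = y <;> simp_all

/-! ### Gluing two halves along crossing edges -/

theorem IsPairedTwoCoverableOn.isHamConnectedOn {S : Finset V} (h : G.IsPairedTwoCoverableOn S)
    (hdeg : ∀ s ∈ S, ∀ F : Finset V, F.card < 3 → ∃ t ∈ S, G.Adj s t ∧ t ∉ F) :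
    G.IsHamConnectedOn S := by
  intro u hu v hv huv
  -- The Hamiltonian path is a path from `u` to `x`, the edge `xy`, and a path from `y` to `v`.
  obtain ⟨x, hx, hux, hxF⟩ := hdeg u hu {v} (by simp)
  obtain ⟨y, hy, hxy, hyF⟩ := hdeg x hx {u, v} (Finset.card_le_two.trans_lt (by simp))
  simp only [Finset.mem_insert, Finset.mem_singleton, not_or] at hxF hyF
  obtain ⟨T, R, hd, rfl, h₁, h₂⟩ := h u hu x hx y hy v hv hux.ne (Ne.symm hyF.1) huv hxy.ne hxF
    hyF.2
  exact h₁.append h₂ hxy hd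

theorem HasPathPairOn.of_crossing_edges {A B : Finset V} {u v x y a b a' b' : V}
    (h₁ : G.HasPathPairOn A u a x b) (h₂ : G.HasPathPairOn B a' v b' y)
    (hAB : Disjoint A B) (ha : G.Adj a a') (hb : G.Adj b b') :
    G.HasPathPairOn (A ∪ B) u v x y := by
  obtain ⟨T, R, hd, rfl, hT, hR⟩ := h₁
  obtain ⟨T', R', hd', rfl, hT', hR'⟩ := h₂
  simp only [Finset.disjoint_union_left, Finset.disjoint_union_right] at hAB
  refine ⟨T ∪ T', R ∪ R', ?_, Finset.union_union_union_comm _ _ _ _, hT.append hT' ha hAB.1.1,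
    hR.append hR' hb hAB.2.2⟩
  simp only [Finset.disjoint_union_left, Finset.disjoint_union_right]
  exact ⟨⟨hd, hAB.1.2.symm⟩, hAB.2.1, hd'⟩

theorem HasPathPairOn.of_crossing_edge {A B : Finset V} {u v x y a a' : V}
    (h₁ : G.HasPathPairOn A u a x y) (h₂ : G.HasPathOn B a' v)
    (hAB : Disjoint A B) (ha : G.Adj a a') : G.HasPathPairOn (A ∪ B) u v x y := by
  obtain ⟨T, R, hd, rfl, hT, hR⟩ := h₁
  simp only [Finset.disjoint_union_left] at hAB
  refine ⟨T ∪ B, R, ?_, Finset.union_right_comm _ _ _, hT.append h₂ ha hAB.1, hR⟩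
  simp only [Finset.disjoint_union_left]
  exact ⟨hd, hAB.2.symm⟩

/-- Pick `a`, `b` in `A` and a neighbour `a'` of `a`. If `b` has no further admissible neighbour,
its neighbours in `B` are exactly `a'`, `v`, `y`. Then `b` takes `a'`, and `a` takes a neighbour
outside `{a', v}`; this is not `y`, since `a` and `b` have only one common neighbour in `B`. -/
theorem hasTwoCrossingEdges_of_degree {A B : Finset V} (hA : 4 ≤ A.card)
    (hdeg : ∀ a ∈ A, ∀ F : Finset V, F.card < 3 → ∃ t ∈ B, G.Adj a t ∧ t ∉ F)
    (huniq : ∀ a ∈ A, ∀ b ∈ A, a ≠ b → ∀ c ∈ B, ∀ d ∈ B, G.Adj a c → G.Adj b c → G.Adj a d →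
      G.Adj b d → c = d) :
    G.HasTwoCrossingEdges A B := by
  have hdeg' : ∀ a ∈ A, ∀ f g : V, ∃ t ∈ B, G.Adj a t ∧ t ≠ f ∧ t ≠ g := fun a ha f g => by
    simpa using hdeg a ha {f, g} (Finset.card_le_two.trans_lt (by simp))
  intro u x v y
  obtain ⟨a, ha, haF⟩ := Finset.exists_mem_notMem_of_card_lt_card (s := {u, x}) (t := A)
    (Finset.card_le_two.trans_lt (by omega))
  obtain ⟨b, hb, hbF⟩ := Finset.exists_mem_notMem_of_card_lt_card (s := {u, x, a}) (t := A)
    (Finset.card_le_three.trans_lt (by omega))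
  simp only [Finset.mem_insert, Finset.mem_singleton, not_or] at haF hbF
  obtain ⟨a', ha', haa', h₁, h₂⟩ := hdeg' a ha v y
  by_cases hex : ∃ b' ∈ B, G.Adj b b' ∧ a' ≠ b' ∧ b' ≠ v ∧ b' ≠ y
  · obtain ⟨b', hb', hbb', h⟩ := hex
    exact ⟨a, ha, b, hb, a', ha', b', hb', haa', hbb', Ne.symm hbF.2.2, by tauto⟩
  · push Not at hex
    have hba' : G.Adj b a' := by
      obtain ⟨t, ht, hbt, h₃, h₄⟩ := hdeg' b hb v y
      by_cases h : a' = t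
      · exact h ▸ hbt
      · exact absurd (hex t ht hbt h h₃) h₄
    have hby : y ∈ B ∧ G.Adj b y := by
      obtain ⟨t, ht, hbt, h₃, h₄⟩ := hdeg' b hb a' v
      have := hex t ht hbt h₃.symm h₄
      exact this ▸ ⟨ht, hbt⟩
    obtain ⟨t, ht, hat, h₃, h₄⟩ := hdeg' a ha a' v
    have hty : t ≠ y := by
      rintro rfl
      exact h₃ (huniq a ha b hb (Ne.symm hbF.2.2) t ht a' ha' hat hby.2 haa' hba')
    exact ⟨a, ha, b, hb, t, ht, a', ha', hat, hba', Ne.symm hbF.2.2, by tauto⟩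

theorem HasPathPairOn.of_split {A B : Finset V} (hAB : Disjoint A B)
    (hA : G.IsPairedTwoCoverableOn A) (hB : G.IsPairedTwoCoverableOn B)
    (hA' : G.IsHamConnectedOn A) (hB' : G.IsHamConnectedOn B)
    (hAc : 4 ≤ A.card) (hBc : 4 ≤ B.card)
    (hdA : ∀ a ∈ A, ∀ F : Finset V, F.card < 2 → ∃ t ∈ B, G.Adj a t ∧ t ∉ F)
    (hdB : ∀ b ∈ B, ∀ F : Finset V, F.card < 2 → ∃ t ∈ A, G.Adj b t ∧ t ∉ F)
    (htwo : G.HasTwoCrossingEdges A B)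
    {u v x y : V} (hu : u ∈ A) (hv : v ∈ B) (hx : x ∈ A ∪ B) (hy : y ∈ A ∪ B)
    (hux : u ≠ x) (huy : u ≠ y) (hvx : v ≠ x) (hvy : v ≠ y) (hxy : x ≠ y) :
    G.HasPathPairOn (A ∪ B) u v x y := by
  have hcross : ∀ {x y : V}, x ∈ A → y ∈ B → u ≠ x → v ≠ y →
      G.HasPathPairOn (A ∪ B) u v x y := by
    intro x y hx hy hux hvy
    obtain ⟨a, ha, b, hb, a', ha', b', hb', h₁, h₂, h₃, h₄, h₅, h₆, h₇, h₈, h₉, h₁₀, h₁₁, h₁₂⟩ :=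
      htwo u x v y
    exact HasPathPairOn.of_crossing_edges
      (hA u hu a ha x hx b hb h₅.symm hux h₇.symm h₆ h₃ h₈.symm)
      (hB a' ha' v hv b' hb' y hy h₉ h₄ h₁₀ h₁₁.symm hvy h₁₂) hAB h₁ h₂
  -- Quantified over `A` and `B` afresh, to serve also with the sides exchanged, when `x` and `y`
  -- lie with `v`.
  have hthree : ∀ {A B : Finset V}, Disjoint A B → G.IsPairedTwoCoverableOn A →
      G.IsHamConnectedOn B → 4 ≤ A.card →
      (∀ a ∈ A, ∀ F : Finset V, F.card < 2 → ∃ t ∈ B, G.Adj a t ∧ t ∉ F) →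
      ∀ {u v x y : V}, u ∈ A → v ∈ B → x ∈ A → y ∈ A → u ≠ x → u ≠ y → x ≠ y →
      G.HasPathPairOn (A ∪ B) u v x y := by
    intro A B hAB hA hB' hAc hdA u v x y hu hv hx hy hux huy hxy
    obtain ⟨a, ha, haF⟩ := Finset.exists_mem_notMem_of_card_lt_card (s := {u, x, y}) (t := A)
      (Finset.card_le_three.trans_lt (by omega))
    simp only [Finset.mem_insert, Finset.mem_singleton, not_or] at haF
    obtain ⟨a', ha', haa', hne⟩ := hdA a ha {v} (by simp)
    exact HasPathPairOn.of_crossing_edge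
      (hA u hu a ha x hx y hy (Ne.symm haF.1) hux huy haF.2.1 haF.2.2 hxy)
      (hB' a' ha' v hv (by simpa using hne)) hAB haa'
  rcases Finset.mem_union.1 hx with hx | hx <;> rcases Finset.mem_union.1 hy with hy | hy
  · exact hthree hAB hA hB' hAc hdA hu hv hx hy hux huy hxy
  · exact hcross hx hy hux hvy
  · exact (hcross hy hx huy hvx).symm_right
  · rw [Finset.union_comm]
    exact (hthree hAB.symm hB hA' hBc hdB hv hu hx hy hvx hvy hxy).symm_left

/-! ### The octahedron -/

theorem HasPathOn.quadruple {u c d v : V} (h₁ : G.Adj u c) (h₂ : G.Adj c d) (h₃ : G.Adj d v)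
    (huv : u ≠ v) (hud : u ≠ d) (hcv : c ≠ v) : G.HasPathOn {u, c, d, v} u v :=
  (HasPathOn.triple h₂ h₃ hcv).cons h₁ (by simp [h₁.ne, huv, hud])

/-- An octahedron is paired 2-coverable. -/
theorem isPairedTwoCoverableOn_of_antipode {S : Finset V} (hS : S.card = 6) (σ : V → V)
    (hσσ : ∀ s ∈ S, σ (σ s) = s)
    (hadj : ∀ s ∈ S, ∀ t ∈ S, s ≠ t → σ s ≠ t → G.Adj s t) : G.IsPairedTwoCoverableOn S := by
  intro u hu v hv x hx y hy huv hux huy hvx hvy hxy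
  have hcard : (S \ {u, v, x, y}).card = 2 := by
    rw [Finset.card_sdiff_of_subset (by simp [Finset.insert_subset_iff, hu, hv, hx, hy]), hS]
    simp [*]
  obtain ⟨c, d, hcd, hc⟩ := Finset.card_eq_two.1 hcard
  have hmem : ∀ w, w ∈ S ↔ w = u ∨ w = v ∨ w = x ∨ w = y ∨ w = c ∨ w = d := by
    intro w
    have := Finset.ext_iff.1 hc w
    simp only [Finset.mem_sdiff, Finset.mem_insert, Finset.mem_singleton] at this
    by_cases hw : w = u ∨ w = v ∨ w = x ∨ w = y
    · rcases hw with rfl | rfl | rfl | rfl <;> simp [*]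
    · tauto
  have hc' := Finset.ext_iff.1 hc c
  have hd' := Finset.ext_iff.1 hc d
  simp only [Finset.mem_sdiff, Finset.mem_insert, Finset.mem_singleton, true_or, or_true,
    iff_true, not_or] at hc' hd'
  obtain ⟨hcS, hcu, hcv, hcx, hcy⟩ := hc'
  obtain ⟨hdS, hdu, hdv, hdx, hdy⟩ := hd'
  have key : ∀ T R : Finset V, (∀ w, w ∈ T → w ∉ R) →
      (∀ w, (w ∈ T ∨ w ∈ R) ↔ w = u ∨ w = v ∨ w = x ∨ w = y ∨ w = c ∨ w = d) →
      G.HasPathOn T u v → G.HasPathOn R x y → G.HasPathPairOn S u v x y :=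
    fun T R h₁ h₂ h₃ h₄ => ⟨T, R, Finset.disjoint_left.2 h₁, by
      ext w; rw [Finset.mem_union, h₂, hmem], h₃, h₄⟩
  have split₁ : G.Adj u c → G.Adj c v → G.Adj x d → G.Adj d y → G.HasPathPairOn S u v x y :=
    fun h₁ h₂ h₃ h₄ => key {u, c, v} {x, d, y} (by simp; grind) (by simp; grind)
      (.triple h₁ h₂ huv) (.triple h₃ h₄ hxy)
  have split₂ : G.Adj u d → G.Adj d v → G.Adj x c → G.Adj c y → G.HasPathPairOn S u v x y :=
    fun h₁ h₂ h₃ h₄ => key {u, d, v} {x, c, y} (by simp; grind) (by simp; grind)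
      (.triple h₁ h₂ huv) (.triple h₃ h₄ hxy)
  have split₃ : G.Adj u c → G.Adj c d → G.Adj d v → G.Adj x y → G.HasPathPairOn S u v x y :=
    fun h₁ h₂ h₃ h₄ => key {u, c, d, v} {x, y} (by simp; grind) (by simp; grind)
      (.quadruple h₁ h₂ h₃ huv (Ne.symm hdu) hcv) (.pair h₄)
  have split₄ : G.Adj u v → G.Adj x c → G.Adj c d → G.Adj d y → G.HasPathPairOn S u v x y :=
    fun h₁ h₂ h₃ h₄ => key {u, v} {x, c, d, y} (by simp; grind) (by simp; grind)
      (.pair h₁) (.quadruple h₂ h₃ h₄ hxy (Ne.symm hdx) hcy)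
  have auv := hadj u hu v hv
  have axy := hadj x hx y hy
  have acd := hadj c hcS d hdS
  have auc := hadj u hu c hcS
  have aud := hadj u hu d hdS
  have acv := hadj c hcS v hv
  have adv := hadj d hdS v hv
  have axc := hadj x hx c hcS
  have axd := hadj x hx d hdS
  have acy := hadj c hcS y hy
  have ady := hadj d hdS y hy
  have iu := hσσ u hu
  have iv := hσσ v hv
  have ix := hσσ x hx
  have iy := hσσ y hy
  have ic := hσσ c hcS
  have id' := hσσ d hdS
  clear key hc hcard hmem hadj hσσ hS
  -- Only antipodal pairs can fail to be adjacent, so each of `c`, `d` may be inserted into a path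
  -- whose ends are not its antipode; both fit into the same path if also `σ c ≠ d`.
  by_cases h₁ : σ u = v
  · by_cases h₂ : σ x = y
    · exact split₁ (by grind) (by grind) (by grind) (by grind)
    · by_cases h₃ : σ c = d
      · exact split₁ (by grind) (by grind) (by grind) (by grind)
      · exact split₃ (by grind) (by grind) (by grind) (by grind)
  · by_cases h₂ : σ x = y
    · by_cases h₃ : σ c = d
      · exact split₁ (by grind) (by grind) (by grind) (by grind)
      · exact split₄ (by grind) (by grind) (by grind) (by grind)
    · by_cases h₃ : σ c = d
      · exact split₁ (by grind) (by grind) (by grind) (by grind)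
      · by_cases hcuv : σ c = u ∨ σ c = v
        · by_cases hduv : σ d = u ∨ σ d = v
          · exact split₄ (by grind) (by grind) (by grind) (by grind)
          · exact split₂ (by grind) (by grind) (by grind) (by grind)
        · by_cases hduv : σ d = u ∨ σ d = v
          · exact split₁ (by grind) (by grind) (by grind) (by grind)
          · exact split₃ (by grind) (by grind) (by grind) (by grind)

end SimpleGraph

/-! ### Slices of the Johnson graph: degrees and base cases -/

/-- The `k`-element sets lying between `C` and `D`. -/
def johnsonSlice {n k : ℕ} (C D : Finset (Fin n)) : Finset {s : Finset (Fin n) // s.card = k} :=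
  Finset.univ.filter fun s => C ⊆ s.1 ∧ s.1 ⊆ D

section Slice

variable {n k : ℕ} {C D : Finset (Fin n)} {s t : {s : Finset (Fin n) // s.card = k}}

theorem mem_johnsonSlice : s ∈ johnsonSlice C D ↔ C ⊆ s.1 ∧ s.1 ⊆ D := by
  simp [johnsonSlice]

theorem card_inter_lt_of_ne (h : s ≠ t) : (s.1 ∩ t.1).card < k := by
  by_contra! hcon
  have h₁ : s.1 ∩ t.1 = s.1 :=
    Finset.eq_of_subset_of_card_le Finset.inter_subset_left (by rw [s.2]; exact hcon)
  have h₂ : s.1 ∩ t.1 = t.1 :=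
    Finset.eq_of_subset_of_card_le Finset.inter_subset_right (by rw [t.2]; exact hcon)
  exact h (Subtype.ext (h₁.symm.trans h₂))

/-- Exchanging `i ∈ s` for `f ∉ s`. -/
def johnsonExchange (s : {s : Finset (Fin n) // s.card = k}) (i f : Fin n) (hi : i ∈ s.1)
    (hf : f ∉ s.1) : {s : Finset (Fin n) // s.card = k} :=
  ⟨insert f (s.1.erase i), by
    rw [Finset.card_insert_of_notMem (by simp [hf]), Finset.card_erase_add_one hi, s.2]⟩

theorem adj_johnsonExchange {i f : Fin n} (hi : i ∈ s.1) (hf : f ∉ s.1) :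
    (johnsonGraph n k).Adj s (johnsonExchange s i f hi hf) := by
  have : s.1 ∩ insert f (s.1.erase i) = s.1.erase i := by
    ext w
    by_cases hw : w = f
    · subst hw; simp [hf]
    · simp [hw]
  change (s.1 ∩ insert f (s.1.erase i)).card + 1 = k
  rw [this, Finset.card_erase_add_one hi, s.2]

/-- Distinct pairs `(i, f)` yield distinct neighbours of `s`. The degree bounds below come from
suitable choices of `P`. -/
theorem exists_exchange_notMem {P : Finset (Fin n × Fin n)} (hP : ∀ p ∈ P, p.1 ∈ s.1 ∧ p.2 ∉ s.1)
    (F : Finset {s : Finset (Fin n) // s.card = k}) (hF : F.card < P.card) :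
    ∃ (i f : Fin n) (hi : i ∈ s.1) (hf : f ∉ s.1), (i, f) ∈ P ∧ johnsonExchange s i f hi hf ∉ F := by
  have hinj : Set.InjOn (fun p : P => johnsonExchange s p.1.1 p.1.2 (hP p.1 p.2).1 (hP p.1 p.2).2)
      (P.attach : Set P) := by
    rintro ⟨⟨i, f⟩, hp⟩ - ⟨⟨j, g⟩, hq⟩ - h
    have h' : insert f (s.1.erase i) = insert g (s.1.erase j) := congrArg Subtype.val h
    have hi := hP _ hp
    have hj := hP _ hq
    simp only at hi hj
    have e₁ := Finset.ext_iff.1 h' f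
    have e₂ := Finset.ext_iff.1 h' i
    simp only [Finset.mem_insert, Finset.mem_erase] at e₁ e₂
    have hfg : f = g := by tauto
    have hif : i ≠ f := by rintro rfl; exact hi.2 hi.1
    have hij : i = j := by
      by_contra hne
      have : i = f := by tauto
      exact hif this
    simp [hfg, hij]
  have hcard := Finset.card_image_of_injOn hinj
  rw [Finset.card_attach] at hcard
  obtain ⟨t, ht, htF⟩ := Finset.exists_mem_notMem_of_card_lt_card (hF.trans_eq hcard.symm)
  obtain ⟨⟨p, hp⟩, -, rfl⟩ := Finset.mem_image.1 ht
  exact ⟨p.1, p.2, (hP p hp).1, (hP p hp).2, hp, htF⟩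

theorem exists_adj_mem_johnsonSlice (hC : C.card < k) (hD : k < D.card) (hCD : C.card + 4 ≤ D.card)
    (hs : s ∈ johnsonSlice C D) (F : Finset {s : Finset (Fin n) // s.card = k}) (hF : F.card < 3) :
    ∃ t ∈ johnsonSlice C D, (johnsonGraph n k).Adj s t ∧ t ∉ F := by
  obtain ⟨hCs, hsD⟩ := mem_johnsonSlice.1 hs
  have h₁ : (s.1 \ C).card = k - C.card := by rw [Finset.card_sdiff_of_subset hCs, s.2]
  have h₂ : (D \ s.1).card = D.card - k := by rw [Finset.card_sdiff_of_subset hsD, s.2]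
  obtain ⟨i, f, hi, hf, hP, ht⟩ := exists_exchange_notMem (s := s) (P := (s.1 \ C) ×ˢ (D \ s.1))
    (fun p hp => by
      simp only [Finset.mem_product, Finset.mem_sdiff] at hp
      tauto) F (by
      rw [Finset.card_product, h₁, h₂]
      obtain ⟨a, rfl⟩ := Nat.exists_eq_add_of_lt hC
      obtain ⟨b, hb⟩ := Nat.exists_eq_add_of_lt hD
      rw [hb, show C.card + a + 1 - C.card = a + 1 by omega,
        show C.card + a + 1 + b + 1 - (C.card + a + 1) = b + 1 by omega]
      -- The degree is `(a + 1) * (b + 1) ≥ a + b + 1 ≥ 3`.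
      nlinarith [Nat.zero_le (a * b)])
  refine ⟨_, ?_, adj_johnsonExchange hi hf, ht⟩
  simp only [Finset.mem_product, Finset.mem_sdiff] at hP
  refine mem_johnsonSlice.2 ⟨fun w hw => ?_, fun w hw => ?_⟩
  · have : w ≠ i := by rintro rfl; exact hP.1.2 hw
    simp [johnsonExchange, this, hCs hw]
  · simp only [johnsonExchange, Finset.mem_insert, Finset.mem_erase] at hw
    rcases hw with rfl | hw
    · exact hP.2.1
    · exact hsD hw.2

theorem card_johnsonSlice : (johnsonSlice (k := k) C D).card = if C ⊆ D ∧ C.card ≤ k then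
    (D.card - C.card).choose (k - C.card) else 0 := by
  split_ifs with h
  · obtain ⟨hCD, hCk⟩ := h
    rw [← Finset.card_sdiff_of_subset hCD, ← Finset.card_powersetCard]
    refine Finset.card_bij (fun s _ => s.1 \ C) ?_ ?_ ?_
    · intro s hs
      obtain ⟨h₁, h₂⟩ := mem_johnsonSlice.1 hs
      exact Finset.mem_powersetCard.2
        ⟨Finset.sdiff_subset_sdiff h₂ le_rfl, by rw [Finset.card_sdiff_of_subset h₁, s.2]⟩
    · intro s hs t ht h
      have h₁ := Finset.sdiff_union_of_subset (mem_johnsonSlice.1 hs).1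
      have h₂ := Finset.sdiff_union_of_subset (mem_johnsonSlice.1 ht).1
      exact Subtype.ext (by rw [← h₁, ← h₂, h])
    · intro r hr
      obtain ⟨h₁, h₂⟩ := Finset.mem_powersetCard.1 hr
      have hd : Disjoint r C := Finset.disjoint_of_subset_left h₁ Finset.sdiff_disjoint
      refine ⟨⟨r ∪ C, by rw [Finset.card_union_of_disjoint hd]; omega⟩, mem_johnsonSlice.2
        ⟨Finset.subset_union_right, Finset.union_subset (h₁.trans Finset.sdiff_subset) hCD⟩, ?_⟩
      exact Finset.union_sdiff_cancel_right hd
  · rw [Finset.card_eq_zero, Finset.eq_empty_iff_forall_notMem]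
    intro s hs
    obtain ⟨h₁, h₂⟩ := mem_johnsonSlice.1 hs
    exact h ⟨h₁.trans h₂, (Finset.card_le_card h₁).trans_eq s.2⟩

theorem four_le_card_johnsonSlice (hC : C.card < k) (hD : k < D.card)
    (hCD : C.card + 4 ≤ D.card) (hs : s ∈ johnsonSlice C D) :
    4 ≤ (johnsonSlice (k := k) C D).card := by
  by_contra! hcon
  obtain ⟨t, ht, hst, hF⟩ := exists_adj_mem_johnsonSlice hC hD hCD hs
    ((johnsonSlice C D).erase s) (by rw [Finset.card_erase_of_mem hs]; omega)
  exact hF (Finset.mem_erase.2 ⟨hst.ne', ht⟩)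

/-- A copy of `J(4,2)`, the octahedron, with complementation inside `D \ C` as antipodal map. -/
theorem isPairedTwoCoverableOn_johnsonSlice_of_card_eq_four (hCD : C ⊆ D)
    (hC : C.card + 2 = k) (hD : k + 2 = D.card) :
    (johnsonGraph n k).IsPairedTwoCoverableOn (johnsonSlice C D) := by
  have hcompl : ∀ s : {s : Finset (Fin n) // s.card = k}, s ∈ johnsonSlice C D →
      (C ∪ D \ s.1).card = k := by
    intro s hs
    obtain ⟨h₁, h₂⟩ := mem_johnsonSlice.1 hs
    rw [Finset.card_union_of_disjoint (Finset.disjoint_of_subset_left h₁ Finset.disjoint_sdiff),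
      Finset.card_sdiff_of_subset h₂, s.2]
    omega
  classical
  let σ : {s : Finset (Fin n) // s.card = k} → {s : Finset (Fin n) // s.card = k} :=
    fun s => if h : s ∈ johnsonSlice C D then ⟨C ∪ D \ s.1, hcompl s h⟩ else s
  have hσ : ∀ s, s ∈ johnsonSlice C D → (σ s).1 = C ∪ D \ s.1 := by
    intro s hs
    simp [σ, hs]
  have hmem : ∀ s ∈ johnsonSlice C D, σ s ∈ johnsonSlice C D := by
    intro s hs
    rw [mem_johnsonSlice, hσ s hs]
    exact ⟨Finset.subset_union_left, Finset.union_subset hCD Finset.sdiff_subset⟩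
  refine SimpleGraph.isPairedTwoCoverableOn_of_antipode ?_ σ ?_ ?_
  · rw [card_johnsonSlice, if_pos ⟨hCD, by omega⟩, show D.card - C.card = 4 by omega,
      show k - C.card = 2 by omega]
    rfl
  · intro s hs
    refine Subtype.ext ?_
    rw [hσ _ (hmem s hs), hσ s hs]
    obtain ⟨h₁, h₂⟩ := mem_johnsonSlice.1 hs
    ext w
    have := @h₁ w
    have := @h₂ w
    have := @hCD w
    simp only [Finset.mem_union, Finset.mem_sdiff]
    tauto
  · intro s hs t ht hst hne
    obtain ⟨h₁, h₂⟩ := mem_johnsonSlice.1 hs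
    obtain ⟨h₃, h₄⟩ := mem_johnsonSlice.1 ht
    have hlt := card_inter_lt_of_ne hst
    have hle := Finset.card_le_card (Finset.subset_inter h₁ h₃)
    change (s.1 ∩ t.1).card + 1 = k
    by_contra hcon
    -- Distinct nonadjacent sets meet in only `k - 2 = |C|` elements, hence in `C`; their union is
    -- then `D`, so they are complementary.
    have hC' : C = s.1 ∩ t.1 :=
      Finset.eq_of_subset_of_card_le (Finset.subset_inter h₁ h₃) (by omega)
    have hu := Finset.card_union_add_card_inter s.1 t.1
    rw [s.2, t.2] at hu
    have hD' : s.1 ∪ t.1 = D :=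
      Finset.eq_of_subset_of_card_le (Finset.union_subset h₂ h₄) (by omega)
    refine hne (Subtype.ext ?_)
    rw [hσ s hs, hC', ← hD']
    ext w
    simp only [Finset.mem_union, Finset.mem_inter, Finset.mem_sdiff]
    tauto

/-- The slice is a clique: two members share the `k - 1` elements of `C`, or have a union of at most
`k + 1` elements. -/
theorem isPairedTwoCoverableOn_johnsonSlice_of_extremal (h : k = C.card + 1 ∨ D.card = k + 1) :
    (johnsonGraph n k).IsPairedTwoCoverableOn (johnsonSlice C D) := by
  refine SimpleGraph.isPairedTwoCoverableOn_of_clique fun s hs t ht hst => ?_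
  obtain ⟨h₁, h₂⟩ := mem_johnsonSlice.1 hs
  obtain ⟨h₃, h₄⟩ := mem_johnsonSlice.1 ht
  have hlt := card_inter_lt_of_ne hst
  have hle := Finset.card_le_card (Finset.subset_inter h₁ h₃)
  have hle' := Finset.card_le_card (Finset.union_subset h₂ h₄)
  have hu := Finset.card_union_add_card_inter s.1 t.1
  rw [s.2, t.2] at hu
  change (s.1 ∩ t.1).card + 1 = k
  omega

/-! ### Splitting a slice by membership of an element -/

theorem mem_johnsonSlice_insert {e : Fin n} :
    s ∈ johnsonSlice (insert e C) D ↔ s ∈ johnsonSlice C D ∧ e ∈ s.1 := by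
  simp only [mem_johnsonSlice, Finset.insert_subset_iff]
  tauto

theorem mem_johnsonSlice_erase {e : Fin n} :
    s ∈ johnsonSlice C (D.erase e) ↔ s ∈ johnsonSlice C D ∧ e ∉ s.1 := by
  simp only [mem_johnsonSlice, Finset.subset_erase]
  tauto

theorem johnsonSlice_insert_union_erase (e : Fin n) :
    johnsonSlice (k := k) (insert e C) D ∪ johnsonSlice C (D.erase e) = johnsonSlice C D := by
  ext s
  rw [Finset.mem_union, mem_johnsonSlice_insert, mem_johnsonSlice_erase]
  tauto

theorem disjoint_johnsonSlice_insert_erase (e : Fin n) :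
    Disjoint (johnsonSlice (k := k) (insert e C) D) (johnsonSlice C (D.erase e)) := by
  rw [Finset.disjoint_left]
  intro s h₁ h₂
  exact (mem_johnsonSlice_erase.1 h₂).2 (mem_johnsonSlice_insert.1 h₁).2

/-- Exchanging `e` for any of the `|D| - k` elements of `D \ s` leads to the other half. -/
theorem exists_adj_mem_erase {e : Fin n} (heC : e ∉ C) (hs : s ∈ johnsonSlice (insert e C) D)
    (F : Finset {s : Finset (Fin n) // s.card = k}) (hF : F.card < D.card - k) :
    ∃ t ∈ johnsonSlice C (D.erase e), (johnsonGraph n k).Adj s t ∧ t ∉ F := by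
  obtain ⟨hs, hes⟩ := mem_johnsonSlice_insert.1 hs
  obtain ⟨h₁, h₂⟩ := mem_johnsonSlice.1 hs
  obtain ⟨i, f, hi, hf, hP, ht⟩ := exists_exchange_notMem (s := s) (P := {e} ×ˢ (D \ s.1))
    (fun p hp => by
      simp only [Finset.mem_product, Finset.mem_sdiff, Finset.mem_singleton] at hp
      exact ⟨hp.1 ▸ hes, hp.2.2⟩) F
    (by rwa [Finset.card_product, Finset.card_singleton, one_mul,
      Finset.card_sdiff_of_subset h₂, s.2])
  simp only [Finset.mem_product, Finset.mem_sdiff, Finset.mem_singleton] at hP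
  obtain ⟨rfl, hfD, -⟩ := hP
  have hne : i ≠ f := by rintro rfl; exact hf hi
  refine ⟨_, ?_, adj_johnsonExchange hi hf, ht⟩
  rw [mem_johnsonSlice_erase, mem_johnsonSlice]
  refine ⟨⟨fun w hw => ?_, fun w hw => ?_⟩, by simp [johnsonExchange, hne]⟩
  · have : w ≠ i := by rintro rfl; exact heC hw
    simp [johnsonExchange, this, h₁ hw]
  · simp only [johnsonExchange, Finset.mem_insert, Finset.mem_erase] at hw
    rcases hw with rfl | hw
    · exact hfD
    · exact h₂ hw.2

theorem exists_adj_mem_insert {e : Fin n} (heD : e ∈ D) (hs : s ∈ johnsonSlice C (D.erase e))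
    (F : Finset {s : Finset (Fin n) // s.card = k}) (hF : F.card < k - C.card) :
    ∃ t ∈ johnsonSlice (insert e C) D, (johnsonGraph n k).Adj s t ∧ t ∉ F := by
  obtain ⟨hs, hes⟩ := mem_johnsonSlice_erase.1 hs
  obtain ⟨h₁, h₂⟩ := mem_johnsonSlice.1 hs
  obtain ⟨i, f, hi, hf, hP, ht⟩ := exists_exchange_notMem (s := s) (P := (s.1 \ C) ×ˢ {e})
    (fun p hp => by
      simp only [Finset.mem_product, Finset.mem_sdiff, Finset.mem_singleton] at hp
      exact ⟨hp.1.1, hp.2 ▸ hes⟩) F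
    (by rwa [Finset.card_product, Finset.card_singleton, mul_one,
      Finset.card_sdiff_of_subset h₁, s.2])
  simp only [Finset.mem_product, Finset.mem_sdiff, Finset.mem_singleton] at hP
  obtain ⟨⟨-, hiC⟩, rfl⟩ := hP
  refine ⟨_, ?_, adj_johnsonExchange hi hf, ht⟩
  rw [mem_johnsonSlice_insert, mem_johnsonSlice]
  refine ⟨⟨fun w hw => ?_, fun w hw => ?_⟩, by simp [johnsonExchange]⟩
  · have : w ≠ i := by rintro rfl; exact hiC hw
    simp [johnsonExchange, this, h₁ hw]
  · simp only [johnsonExchange, Finset.mem_insert, Finset.mem_erase] at hw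
    rcases hw with rfl | hw
    · exact heD
    · exact h₂ hw.2

theorem erase_subset_of_adj {e : Fin n} (hes : e ∈ s.1) (het : e ∉ t.1)
    (h : (johnsonGraph n k).Adj s t) : s.1.erase e ⊆ t.1 := by
  have h' : (s.1 ∩ t.1).card + 1 = k := h
  have h₁ : s.1 ∩ t.1 ⊆ s.1.erase e := fun w hw => by
    obtain ⟨h₁, h₂⟩ := Finset.mem_inter.1 hw
    exact Finset.mem_erase.2 ⟨by rintro rfl; exact het h₂, h₁⟩
  have h₂ := Finset.card_erase_add_one hes
  rw [s.2] at h₂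
  rw [← Finset.eq_of_subset_of_card_le h₁ (by omega)]
  exact Finset.inter_subset_right

/-- A common neighbour avoiding `e` contains `(a ∪ b) \ {e}`, which already has at least `k`
elements, so it equals that set. -/
theorem eq_of_adj_of_mem {a b c d : {s : Finset (Fin n) // s.card = k}} {e : Fin n} (hab : a ≠ b)
    (ha : e ∈ a.1) (hb : e ∈ b.1) (hc : e ∉ c.1) (hd : e ∉ d.1)
    (hac : (johnsonGraph n k).Adj a c) (hbc : (johnsonGraph n k).Adj b c)
    (had : (johnsonGraph n k).Adj a d) (hbd : (johnsonGraph n k).Adj b d) : c = d := by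
  have hlt := card_inter_lt_of_ne hab
  have hu := Finset.card_union_add_card_inter a.1 b.1
  have he := Finset.card_erase_add_one (Finset.mem_union_left b.1 ha)
  rw [a.2, b.2] at hu
  have key : ∀ c : {s : Finset (Fin n) // s.card = k}, e ∉ c.1 → (johnsonGraph n k).Adj a c →
      (johnsonGraph n k).Adj b c → (a.1 ∪ b.1).erase e = c.1 := fun c hc h₁ h₂ => by
    refine Finset.eq_of_subset_of_card_le ?_ (by rw [c.2]; omega)
    rw [Finset.erase_union_distrib]
    exact Finset.union_subset (erase_subset_of_adj ha hc h₁) (erase_subset_of_adj hb hc h₂)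
  exact Subtype.ext ((key c hc hac hbc).symm.trans (key d hd had hbd))

theorem eq_of_adj_of_notMem {a b c d : {s : Finset (Fin n) // s.card = k}} {e : Fin n}
    (hab : a ≠ b) (ha : e ∉ a.1) (hb : e ∉ b.1) (hc : e ∈ c.1) (hd : e ∈ d.1)
    (hac : (johnsonGraph n k).Adj a c) (hbc : (johnsonGraph n k).Adj b c)
    (had : (johnsonGraph n k).Adj a d) (hbd : (johnsonGraph n k).Adj b d) : c = d := by
  by_contra hcd
  exact hab (eq_of_adj_of_mem hcd hc hd ha hb hac.symm had.symm hbc.symm hbd.symm)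

end Slice

/-! ### The induction -/

theorem isPairedTwoCoverableOn_johnsonSlice {n k : ℕ} (m : ℕ) (hm : 4 ≤ m) :
    ∀ C D : Finset (Fin n), C ⊆ D → D.card = C.card + m → C.card < k → k < D.card →
      (johnsonGraph n k).IsPairedTwoCoverableOn (johnsonSlice C D) := by
  induction m, hm using Nat.le_induction with
  | base =>
    intro C D hCD hm hC hD
    by_cases h : k = C.card + 1 ∨ D.card = k + 1
    · exact isPairedTwoCoverableOn_johnsonSlice_of_extremal h
    · exact isPairedTwoCoverableOn_johnsonSlice_of_card_eq_four hCD (by omega) (by omega)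
  | succ m hm4 ih =>
    intro C D hCD hm hC hD
    by_cases h : k = C.card + 1 ∨ D.card = k + 1
    · exact isPairedTwoCoverableOn_johnsonSlice_of_extremal h
    -- Now `k - |C|` and `|D| - k` are at least 2, so both halves satisfy the strict bounds of the
    -- induction hypothesis.
    intro u hu v hv x hx y hy huv hux huy hvx hvy hxy
    obtain ⟨e, heu, hev⟩ : ∃ e ∈ u.1, e ∉ v.1 := by
      by_contra! hcon
      exact huv (Subtype.ext (Finset.eq_of_subset_of_card_le hcon (by rw [u.2, v.2])))
    have heC : e ∉ C := fun he => hev ((mem_johnsonSlice.1 hv).1 he)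
    have heD : e ∈ D := (mem_johnsonSlice.1 hu).2 heu
    have hCc : (insert e C).card = C.card + 1 := Finset.card_insert_of_notMem heC
    have hDc : (D.erase e).card + 1 = D.card := Finset.card_erase_add_one heD
    have hA := ih (insert e C) D (Finset.insert_subset heD hCD) (by omega) (by omega) hD
    have hB := ih C (D.erase e) (Finset.subset_erase.2 ⟨hCD, heC⟩) (by omega) hC (by omega)
    have huA : u ∈ johnsonSlice (insert e C) D := mem_johnsonSlice_insert.2 ⟨hu, heu⟩
    have hvB : v ∈ johnsonSlice C (D.erase e) := mem_johnsonSlice_erase.2 ⟨hv, hev⟩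
    have hAc := four_le_card_johnsonSlice (by omega) hD (by omega) huA
    have hBc := four_le_card_johnsonSlice hC (by omega) (by omega) hvB
    have htwo : (johnsonGraph n k).HasTwoCrossingEdges (johnsonSlice (insert e C) D)
        (johnsonSlice C (D.erase e)) := by
      -- The crossing degrees `|D| - k` and `k - |C|` add up to `m + 1 ≥ 5`, so one of them is at
      -- least 3.
      by_cases h3 : 3 ≤ D.card - k
      · refine SimpleGraph.hasTwoCrossingEdges_of_degree hAc
          (fun a ha F hF => exists_adj_mem_erase heC ha F (by omega)) ?_
        intro a ha b hb hab c hc d hd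
        exact eq_of_adj_of_mem hab (mem_johnsonSlice_insert.1 ha).2 (mem_johnsonSlice_insert.1 hb).2
          (mem_johnsonSlice_erase.1 hc).2 (mem_johnsonSlice_erase.1 hd).2
      · refine (SimpleGraph.hasTwoCrossingEdges_of_degree hBc
          (fun a ha F hF => exists_adj_mem_insert heD ha F (by omega)) ?_).symm
        intro a ha b hb hab c hc d hd
        exact eq_of_adj_of_notMem hab (mem_johnsonSlice_erase.1 ha).2
          (mem_johnsonSlice_erase.1 hb).2 (mem_johnsonSlice_insert.1 hc).2
          (mem_johnsonSlice_insert.1 hd).2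
    rw [← johnsonSlice_insert_union_erase e] at hx hy ⊢
    exact SimpleGraph.HasPathPairOn.of_split (disjoint_johnsonSlice_insert_erase e) hA hB
      (hA.isHamConnectedOn fun s hs F hF =>
        exists_adj_mem_johnsonSlice (by omega) hD (by omega) hs F hF)
      (hB.isHamConnectedOn fun s hs F hF =>
        exists_adj_mem_johnsonSlice hC (by omega) (by omega) hs F hF)
      hAc hBc (fun a ha F hF => exists_adj_mem_erase heC ha F (by omega))
      (fun b hb F hF => exists_adj_mem_insert heD hb F (by omega)) htwo huA hvB hx hy
      hux huy hvx hvy hxy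

theorem theorem4 (n k : ℕ) (hn : 4 ≤ n) (hk : 1 ≤ k) (hkn : k < n) :
    (johnsonGraph n k).IsPairedTwoCoverable := by
  intro u v x y huv hux huy hvx hvy hxy
  have hmem : ∀ s : {s : Finset (Fin n) // s.card = k}, s ∈ johnsonSlice ∅ Finset.univ := fun s =>
    mem_johnsonSlice.2 ⟨Finset.empty_subset _, Finset.subset_univ _⟩
  obtain ⟨T, R, hd, hTR, ⟨p, hp, hpT⟩, q, hq, hqR⟩ :=
    isPairedTwoCoverableOn_johnsonSlice (k := k) n hn ∅ Finset.univ (Finset.empty_subset _)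
      (by simp) (by rw [Finset.card_empty]; omega) (by simpa using hkn) u (hmem u) v (hmem v) x (hmem x) y (hmem y)
      huv hux huy hvx hvy hxy
  refine ⟨p, q, hp, hq, fun w hw => ?_, fun w => ?_⟩
  · exact Finset.disjoint_left.1 hd ((hpT w).1 hw.1) ((hqR w).1 hw.2)
  · rw [hpT, hqR, ← Finset.mem_union, hTR]
    exact hmem w
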